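/- **Proposition 5.2.** Let $A=(\Sigma_A,E_A)$ be an algebraic theory: for each $n\in\mathbb N$ a set of $n$-ary operation symbols, and a set of equations, i.e. pairs of terms in finitely many variables. Let $X$ be an $A$-model, let $\kappa$ be a clock, and let $D^\kappa X$ be the guarded delay type, the guarded recursive type with $D^\kappa X\simeq X+\triangleright^\kappa(D^\kappa X)$, with inclusions $\mathsf{now}:X\to D^\kappa X$ and $\mathsf{step}:\triangleright^\kappa D^\kappa X\to D^\kappa X$. The *parallel lifting* of an $n$-ary operation $\mathsf{op}$ is the map $(D^\kappa X)^n\to D^\kappa X$ defined by guarded recursion by $\mathsf{op}^{\parallel}(\mathsf{now}\,x_1,\dots,\mathsf{now}\,x_n)=\mathsf{now}(\mathsf{op}_X(x_1,\dots,x_n))$ and, if at least one $x_i$ is a step, $\mathsf{op}^{\parallel}(x_1,\dots,x_n)=\mathsf{step}(\lambda\alpha.\,\mathsf{op}^{\parallel}(x_1',\dots,x_n'))$, where $\alpha$ ranges over ticks on $\kappa$, $x_i'=x_i$ if $x_i=\mathsf{now}(y)$ and $x_i'=y[\alpha]$ if $x_i=\mathsf{step}(y)$. The parallel lifting $s^{\parallel}$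 of a term $s$ is its interpretation on $D^\kappa X$, by induction on $s$, using the parallel liftings of the operations. An equation $s=t$ is *valid in $A$* if it lies in the smallest congruence containing all substitution instances of $E_A$, and it is a *drop* equation if the sets of variables occurring in $s$ and in $t$ differ. 1. If $s=t$ is a non-drop equation that is valid in $A$, then $s^{\parallel}=t^{\parallel}$ as maps $(D^\kappa X)^m\to D^\kappa X$, where $m$ is the number of variables in the context of $s$ and $t$. 2. If $E_A$ contains no drop equations, then $D^\kappa X$ with the parallel liftings of the operations of $A$ is an $A$-model. *Interpretation.* The statement lives in type theory with clocks and guarded recursion, and is read in its standard set-valued presheaf model, for an arbitrary context $\Gamma$ with a clock $\kappa$. A time object is a pair $(E,\delta)$ of a finite set $E$ of clocks and a map $\delta:E\to\mathbb N$; a morphism $(E,\delta)\to(E',\delta')$ is a map $\sigma:E\to E'$ with $\delta'(\sigma(a))\le\delta(a)$ for all $a\in E$. A context $\Gamma$ is a set-valued functor on time objects, $\kappa$ is a natural choice of a clock $\kappa(\gamma)\in E$ for $\gamma\in\Gamma(E,\delta)$, and a set in context $\Gamma$ is a set-valued functor on the category of elements of $\Gamma$. The notions above (theory, model, term, validity,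 equality of maps) are the internal ones of this functor category; in particular operations, equations and $X$ may vary with the stage, and ordinary sets appear as constant functors. Writing $\gamma^-$ for the restriction of $\gamma$ to the stage where $\delta(\kappa(\gamma))$ is lowered by one, $(\triangleright^\kappa Y)(E,\delta,\gamma)$ is a one-point set if $\delta(\kappa(\gamma))=0$, and $Y(E,\delta[\kappa(\gamma)\mapsto\delta(\kappa(\gamma))-1],\gamma^-)$ otherwise. -/

import Mathlib

open CategoryTheory

universe u v v' w

namespace GuardedDelay

noncomputable section

/-! ### Algebraic theories and their models, in a universe of variable sets

A "set" is a functor `X : C ⥤ Type`, where the objects of `C` are the stages (worlds).  All the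
notions below are the internal notions of algebraic theory, term, derivable equation and model,
computed in the functor category.  Since arities are finite, they are computed stage by stage, and
everything commutes with the passage along a morphism of stages.  For `C` the one-object category
they are the usual notions. -/

/-- A signature: for each arity `n` a variable set of `n`-ary operation symbols. -/
abbrev Signature (C : Type u) [Category C] := ℕ → (C ⥤ Type v)

section Algebra

variable {C : Type w} [Category.{v'} C]

/-- The ordinary signature of the operation symbols available at stage `c`. -/
abbrev Signature.lang (S : Signature.{w, v} C) (c : C) : FirstOrder.Language.{v, 0} where
  Functions n := (S n).obj c
  Relations _ := Empty

/-- Terms at stage `c` in the variable context `x₀, …, x_{m-1}`. -/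
abbrev Signature.Tm (S : Signature.{w, v} C) (c : C) (m : ℕ) := (S.lang c).Term (Fin m)

/-- Translation of operation symbols along a morphism of stages. -/
def Signature.res (S : Signature.{w, v} C) {c d : C} (f : c ⟶ d) : FirstOrder.Language.LHom (S.lang c) (S.lang d) where
  onFunction {n} := fun (o : (S n).obj c) => (S n).map f o
  onRelation {_} := fun (r : Empty) => r.elim

/-- Restriction of a term along a morphism of stages. -/
abbrev Signature.Tm.res {S : Signature.{w, v} C} {c d : C} {m : ℕ} (s : S.Tm c m) (f : c ⟶ d) :
    S.Tm d m := (S.res f).onTerm s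

/-- A pair of terms is a drop equation if different variables appear on the two sides. -/
def IsDrop {S : Signature.{w, v} C} {c : C} {m : ℕ} (s t : S.Tm c m) : Prop :=
  s.varFinset ≠ t.varFinset

variable (C) in
/-- An algebraic theory: a signature, for each `n` a set of equations in `n` free variables, and
the two sides of each equation. -/
structure AlgTheory where
  sig : Signature.{w, v} C
  eqn : ℕ → (C ⥤ Type v)
  lhs : ∀ {n : ℕ} {c : C}, (eqn n).obj c → sig.Tm c n
  rhs : ∀ {n : ℕ} {c : C}, (eqn n).obj c → sig.Tm c n
  lhs_map : ∀ {n : ℕ} {c d : C} (f : c ⟶ d) (e : (eqn n).obj c),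
    lhs ((eqn n).map f e) = (lhs e).res f
  rhs_map : ∀ {n : ℕ} {c d : C} (f : c ⟶ d) (e : (eqn n).obj c),
    rhs ((eqn n).map f e) = (rhs e).res f

/-- Validity of an equation in a theory: the smallest congruence that contains all substitution
instances of the equations of the theory. -/
inductive AlgTheory.Valid (A : AlgTheory.{v, v', w} C) (c : C) {m : ℕ} :
    A.sig.Tm c m → A.sig.Tm c m → Prop
  | ax {n : ℕ} (e : (A.eqn n).obj c) (σ : Fin n → A.sig.Tm c m) :
      Valid A c ((A.lhs e).subst σ) ((A.rhs e).subst σ)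
  | refl (s : A.sig.Tm c m) : Valid A c s s
  | symm {s t : A.sig.Tm c m} : Valid A c s t → Valid A c t s
  | trans {s t r : A.sig.Tm c m} : Valid A c s t → Valid A c t r → Valid A c s r
  | congr {n : ℕ} (o : (A.sig.lang c).Functions n) (ss ts : Fin n → A.sig.Tm c m) :
      (∀ i, Valid A c (ss i) (ts i)) → Valid A c (FirstOrder.Language.Term.func o ss) (FirstOrder.Language.Term.func o ts)

/-- An interpretation of the operation symbols of `S` on the variable set `X`: every `n`-ary symbol
is interpreted as a map `Xⁿ → X`. -/
structure Interp (S : Signature.{w, v} C) (X : C ⥤ Type u) where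
  op : ∀ {c : C} {n : ℕ}, (S n).obj c → (Fin n → X.obj c) → X.obj c
  op_map : ∀ {c d : C} (f : c ⟶ d) {n : ℕ} (o : (S n).obj c) (x : Fin n → X.obj c),
    X.map f (op o x) = op ((S n).map f o) (fun i => X.map f (x i))

/-- The structure, in the sense of ordinary algebra, that an interpretation puts on stage `c`. -/
abbrev Interp.struct {S : Signature.{w, v} C} {X : C ⥤ Type u} (I : Interp S X) (c : C) :
    (S.lang c).Structure (X.obj c) where
  funMap {_} o x := I.op o x
  RelMap {_} r _ := Empty.elim r

/-- Interpretation of a term, by induction on the term. -/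
def Interp.eval {S : Signature.{w, v} C} {X : C ⥤ Type u} (I : Interp S X) {c : C} {m : ℕ}
    (s : S.Tm c m) (ρ : Fin m → X.obj c) : X.obj c :=
  letI := I.struct c
  s.realize ρ

/-- Two terms at stage `c` have the same interpretation as maps `X^m → X`, i.e. as elements at
stage `c` of the internal function space: they agree at all stages reachable from `c`. -/
def Interp.Agree {S : Signature.{w, v} C} {X : C ⥤ Type u} (I : Interp S X) {c : C} {m : ℕ}
    (s t : S.Tm c m) : Prop :=
  ∀ ⦃d : C⦄ (f : c ⟶ d) (ρ : Fin m → X.obj d), I.eval (s.res f) ρ = I.eval (t.res f) ρ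

/-- An interpretation is a model of `A` if it satisfies every equation of `A`. -/
def Interp.IsModel {A : AlgTheory.{v, v', w} C} {X : C ⥤ Type u} (I : Interp A.sig X) : Prop :=
  ∀ ⦃n : ℕ⦄ ⦃c : C⦄ (e : (A.eqn n).obj c), I.Agree (A.lhs e) (A.rhs e)

/-- All equations of the theory are non-drop. -/
def AlgTheory.NoDrop (A : AlgTheory.{v, v', w} C) : Prop :=
  ∀ ⦃n : ℕ⦄ ⦃c : C⦄ (e : (A.eqn n).obj c), ¬ IsDrop (A.lhs e) (A.rhs e)

end Algebra

/-! ### Time objects: the presheaf model of multi-clock guarded recursion -/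

/-- A time object: a finite set of clocks, with the number of ticks left on each of them. -/
structure TimeObj where
  clocks : Finset ℕ
  time : clocks → ℕ

/-- A morphism of time objects renames clocks and lets time pass. -/
@[ext]
structure TimeObj.Hom (T T' : TimeObj) where
  fn : T.clocks → T'.clocks
  le : ∀ a, T'.time (fn a) ≤ T.time a

instance : Category TimeObj where
  Hom := TimeObj.Hom
  id T := ⟨id, fun _ => le_rfl⟩
  comp f g := ⟨g.fn ∘ f.fn, fun a => (g.le _).trans (f.le a)⟩

/-- The underlying renaming of clocks. -/
def TimeObj.rename {T T' : TimeObj} (f : T ⟶ T') : T.clocks → T'.clocks := TimeObj.Hom.fn f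

theorem TimeObj.time_le {T T' : TimeObj} (f : T ⟶ T') (a : T.clocks) :
    T'.time (TimeObj.rename f a) ≤ T.time a := TimeObj.Hom.le f a

theorem TimeObj.hom_ext {T T' : TimeObj} {f g : T ⟶ T'}
    (h : TimeObj.rename f = TimeObj.rename g) : f = g := TimeObj.Hom.ext h

/-- One tick on the clock `a`. -/
def TimeObj.tick (T : TimeObj) (a : T.clocks) : TimeObj where
  clocks := T.clocks
  time := Function.update T.time a (T.time a - 1)

/-- The passage from a time object to the one after a tick. -/
def TimeObj.tickHom (T : TimeObj) (a : T.clocks) : T ⟶ T.tick a :=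
  TimeObj.Hom.mk id (fun b => by
    by_cases h : b = a
    · subst h; simp [TimeObj.tick]
    · simp [TimeObj.tick, h])

theorem TimeObj.tick_time_le {T T' : TimeObj} (f : T ⟶ T') (a b : T.clocks) :
    Function.update T'.time (TimeObj.rename f a) (T'.time (TimeObj.rename f a) - 1)
      (TimeObj.rename f b) ≤ Function.update T.time a (T.time a - 1) b := by
  have h1 := TimeObj.time_le f b
  by_cases h : b = a
  · subst h
    simp only [Function.update_self]
    omega
  · rw [Function.update_of_ne h]
    by_cases h2 : TimeObj.rename f b = TimeObj.rename f a
    · rw [h2, Function.update_self]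
      rw [h2] at h1
      omega
    · rw [Function.update_of_ne h2]
      exact h1

/-- Ticks commute with morphisms of time objects. -/
def TimeObj.tickMap {T T' : TimeObj} (f : T ⟶ T') (a : T.clocks) (a' : T'.clocks)
    (h : TimeObj.rename f a = a') : T.tick a ⟶ T'.tick a' :=
  TimeObj.Hom.mk (TimeObj.rename (T := T) (T' := T') f)
    (by subst h; exact TimeObj.tick_time_le f a)

/-- A clock `κ` in context `Γ`: a natural choice of a clock. -/
structure ClockIn (Γ : TimeObj ⥤ Type w) where
  app : ∀ {T : TimeObj}, Γ.obj T → T.clocks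
  app_map : ∀ {T T' : TimeObj} (f : T ⟶ T') (γ : Γ.obj T),
    app (Γ.map f γ) = TimeObj.rename f (app γ)

section Delay

/- A set in context `Γ` is a functor on the category of elements `Γ.Elements`, whose objects are the
pairs of a time object and an element of the context over it. -/
variable {Γ : TimeObj ⥤ Type w} (κ : ClockIn Γ)

/-- The number of ticks left on the clock `κ` at stage `c`. -/
def ClockIn.level (c : Γ.Elements) : ℕ := c.1.time (κ.app c.2)

/-- The stage after a tick on the clock `κ` (used at stages of positive level only). -/
def ClockIn.next (c : Γ.Elements) : Γ.Elements :=
  ⟨c.1.tick (κ.app c.2), Γ.map (c.1.tickHom (κ.app c.2)) c.2⟩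

/-- The passage to the stage after a tick. -/
def ClockIn.toNext (c : Γ.Elements) : c ⟶ κ.next c := ⟨c.1.tickHom (κ.app c.2), rfl⟩

theorem ClockIn.rename_app {c d : Γ.Elements} (f : c ⟶ d) :
    TimeObj.rename f.1 (κ.app c.2) = κ.app d.2 := by
  rw [← κ.app_map, f.2]

theorem ClockIn.level_le {c d : Γ.Elements} (f : c ⟶ d) : κ.level d ≤ κ.level c := by
  unfold ClockIn.level
  rw [← κ.rename_app f]
  exact TimeObj.time_le f.1 _

theorem ClockIn.level_next (c : Γ.Elements) : κ.level (κ.next c) = κ.level c - 1 := by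
  unfold ClockIn.level ClockIn.next
  simp only [κ.app_map]
  exact Function.update_self _ _ _

/-- A morphism of stages induces a morphism between the stages after a tick. -/
def ClockIn.nextMap {c d : Γ.Elements} (f : c ⟶ d) : κ.next c ⟶ κ.next d :=
  ⟨TimeObj.tickMap f.1 (κ.app c.2) (κ.app d.2) (κ.rename_app f), by
    have h : c.1.tickHom (κ.app c.2) ≫ TimeObj.tickMap f.1 _ _ (κ.rename_app f) =
        f.1 ≫ d.1.tickHom (κ.app d.2) := TimeObj.hom_ext rfl
    have h' := congrArg (fun g => Γ.map g c.2) h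
    simp only [Functor.map_comp_apply, f.2] at h'
    exact h'⟩

theorem ClockIn.nextMap_id (c : Γ.Elements) : κ.nextMap (𝟙 c) = 𝟙 (κ.next c) :=
  CategoryOfElements.ext _ _ _ (TimeObj.hom_ext rfl)

theorem ClockIn.nextMap_comp {c d e : Γ.Elements} (f : c ⟶ d) (g : d ⟶ e) :
    κ.nextMap (f ≫ g) = κ.nextMap f ≫ κ.nextMap g :=
  CategoryOfElements.ext _ _ _ (TimeObj.hom_ext rfl)

theorem ClockIn.toNext_nextMap {c d : Γ.Elements} (f : c ⟶ d) :
    κ.toNext c ≫ κ.nextMap f = f ≫ κ.toNext d :=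
  CategoryOfElements.ext _ _ _ (TimeObj.hom_ext rfl)

/-- The later modality `▷^κ`: an element of `▷^κ Y` is an element of `Y` after one tick on `κ`;
there is exactly one element if no tick is left. -/
def later (Y : Γ.Elements ⥤ Type u) : Γ.Elements ⥤ Type u where
  obj c := 0 < κ.level c → Y.obj (κ.next c)
  map f := ↾fun y h => Y.map (κ.nextMap f) (y (h.trans_le (κ.level_le f)))
  map_id c := by
    ext y h
    simp [κ.nextMap_id]
  map_comp f g := by
    ext y h
    simp [κ.nextMap_comp]

/-- The family underlying the guarded delay monad, `D^κ X ≃ X + ▷^κ (D^κ X)`. -/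
inductive DelayFam (X : Γ.Elements ⥤ Type u) : Γ.Elements → Type (max u w)
  | now {c : Γ.Elements} (x : X.obj c) : DelayFam X c
  | step {c : Γ.Elements} (d : 0 < κ.level c → DelayFam X (κ.next c)) : DelayFam X c

variable {κ}

/-- Restriction of delayed elements along a morphism of stages. -/
def DelayFam.map {X : Γ.Elements ⥤ Type u} {c : Γ.Elements} (x : DelayFam κ X c) :
    ∀ {d : Γ.Elements}, (c ⟶ d) → DelayFam κ X d :=
  DelayFam.rec (motive := fun c _ => ∀ {d : Γ.Elements}, (c ⟶ d) → DelayFam κ X d)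
    (fun x _ f => .now (X.map f x))
    (fun _ ih _ f => .step fun h => ih (h.trans_le (κ.level_le f)) (κ.nextMap f)) x

theorem DelayFam.map_id {X : Γ.Elements ⥤ Type u} {c : Γ.Elements} (x : DelayFam κ X c) :
    x.map (𝟙 c) = x := by
  induction x with
  | now x => simp [DelayFam.map]
  | step d ih =>
    change DelayFam.step _ = _
    congr 1
    funext h
    change (d h).map (κ.nextMap (𝟙 _)) = _
    rw [κ.nextMap_id, ih]

theorem DelayFam.map_comp {X : Γ.Elements ⥤ Type u} {c : Γ.Elements} (x : DelayFam κ X c) :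
    ∀ {d e : Γ.Elements} (f : c ⟶ d) (g : d ⟶ e), x.map (f ≫ g) = (x.map f).map g := by
  induction x with
  | now x => intros; simp [DelayFam.map]
  | step y ih =>
    intro d e f g
    change DelayFam.step _ = DelayFam.step _
    congr 1
    funext h
    change (y _).map (κ.nextMap (f ≫ g)) = ((y _).map (κ.nextMap f)).map (κ.nextMap g)
    rw [κ.nextMap_comp, ih]

variable (κ)

/-- The guarded delay monad `D^κ`, on objects. -/
def delay (X : Γ.Elements ⥤ Type u) : Γ.Elements ⥤ Type (max u w) where
  obj c := DelayFam κ X c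
  map f := ↾fun x => x.map f
  map_id c := by
    ext x
    exact x.map_id
  map_comp f g := by
    ext x
    exact x.map_comp f g

variable {κ}

/-- The inclusion `now : X → D^κ X`. -/
def now {X : Γ.Elements ⥤ Type u} {c : Γ.Elements} (x : X.obj c) : (delay κ X).obj c :=
  DelayFam.now x

/-- The map `step : ▷^κ (D^κ X) → D^κ X`. -/
def step {X : Γ.Elements ⥤ Type u} {c : Γ.Elements} (d : 0 < κ.level c → (delay κ X).obj (κ.next c)) :
    (delay κ X).obj c :=
  DelayFam.step d

theorem map_now {X : Γ.Elements ⥤ Type u} {c d : Γ.Elements} (f : c ⟶ d) (x : X.obj c) :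
    (delay κ X).map f (now x) = now (X.map f x) := rfl

theorem map_step {X : Γ.Elements ⥤ Type u} {c d : Γ.Elements} (f : c ⟶ d)
    (y : 0 < κ.level c → (delay κ X).obj (κ.next c)) :
    (delay κ X).map f (step y) =
      step fun h => (delay κ X).map (κ.nextMap f) (y (h.trans_le (κ.level_le f))) := rfl

/-- The defining equivalence `D^κ X ≃ X + ▷^κ (D^κ X)`; it is natural by `map_now`, `map_step`. -/
def delayEquiv (X : Γ.Elements ⥤ Type u) (c : Γ.Elements) :
    (delay κ X).obj c ≃ X.obj c ⊕ (later κ (delay κ X)).obj c where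
  toFun x := match x with
    | .now x => .inl x
    | .step y => .inr y
  invFun := Sum.elim now step
  left_inv x := by cases x <;> rfl
  right_inv x := by cases x <;> rfl

/-! ### Parallel lifting -/

/-- The value of a terminated computation. -/
def value? {X : Γ.Elements ⥤ Type u} {c : Γ.Elements} (x : (delay κ X).obj c) : Option (X.obj c) :=
  match x with
  | .now x => some x
  | .step _ => none

/-- One tick of an argument: terminated computations are kept, a step is executed. -/
def advance {X : Γ.Elements ⥤ Type u} {c : Γ.Elements} (h : 0 < κ.level c)
    (x : (delay κ X).obj c) : (delay κ X).obj (κ.next c) :=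
  match x with
  | .now x => now (X.map (κ.toNext c) x)
  | .step y => y h

/-- Parallel lifting of an operation, by guarded recursion: if all arguments have terminated, the
operation is applied to their values, otherwise all the arguments that are steps are executed
simultaneously. -/
def parOp {S : Signature.{w, v} Γ.Elements} {X : Γ.Elements ⥤ Type u} (I : Interp S X)
    (c : Γ.Elements) {n : ℕ} (o : (S n).obj c) (x : Fin n → (delay κ X).obj c) :
    (delay κ X).obj c :=
  if h : ∀ i, (value? (x i)).isSome then
    now (I.op o fun i => (value? (x i)).get (h i))
  else
    step fun hc => parOp I (κ.next c) ((S n).map (κ.toNext c) o) fun i => advance hc (x i)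
termination_by κ.level c
decreasing_by
  rw [κ.level_next]
  omega

theorem parOp_now {S : Signature.{w, v} Γ.Elements} {X : Γ.Elements ⥤ Type u} (I : Interp S X)
    {c : Γ.Elements} {n : ℕ} (o : (S n).obj c) (x : Fin n → X.obj c) :
    parOp (κ := κ) I c o (fun i => now (x i)) = now (I.op o x) := by
  rw [parOp, dif_pos (show ∀ i, (value? (κ := κ) (now (x i))).isSome from fun _ => rfl)]
  rfl

theorem parOp_step {S : Signature.{w, v} Γ.Elements} {X : Γ.Elements ⥤ Type u} (I : Interp S X)
    {c : Γ.Elements} {n : ℕ} (o : (S n).obj c) (x : Fin n → (delay κ X).obj c)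
    (hx : ∃ i y, x i = step y) :
    parOp I c o x =
      step fun hc => parOp I (κ.next c) ((S n).map (κ.toNext c) o) fun i => advance hc (x i) := by
  obtain ⟨i, y, hi⟩ := hx
  rw [parOp, dif_neg]
  intro h
  have := h i
  rw [hi] at this
  cases this

theorem forall_now_or_exists_step {X : Γ.Elements ⥤ Type u} {c : Γ.Elements} {n : ℕ}
    (x : Fin n → (delay κ X).obj c) :
    (∃ x' : Fin n → X.obj c, x = fun i => now (x' i)) ∨ ∃ i y, x i = step y := by
  by_cases h : ∃ i y, x i = step y
  · exact .inr h
  · have h' : ∀ i, ∃ z, x i = now z := by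
      intro i
      cases hi : x i with
      | now z => exact ⟨z, rfl⟩
      | step y => exact absurd ⟨i, y, hi⟩ h
    choose x' hx' using h'
    exact .inl ⟨x', funext hx'⟩

theorem advance_map {X : Γ.Elements ⥤ Type u} {c d : Γ.Elements} (f : c ⟶ d) (h : 0 < κ.level d)
    (x : (delay κ X).obj c) :
    advance h ((delay κ X).map f x) =
      (delay κ X).map (κ.nextMap f) (advance (h.trans_le (κ.level_le f)) x) := by
  cases x with
  | now x =>
    change now (X.map _ (X.map f x)) = now (X.map _ (X.map _ x))
    rw [← Functor.map_comp_apply, ← Functor.map_comp_apply, κ.toNext_nextMap]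
  | step y => rfl

theorem map_parOp {S : Signature.{w, v} Γ.Elements} {X : Γ.Elements ⥤ Type u} (I : Interp S X)
    (k : ℕ) : ∀ {c d : Γ.Elements}, κ.level c = k → ∀ (f : c ⟶ d) {n : ℕ} (o : (S n).obj c)
      (x : Fin n → (delay κ X).obj c),
      (delay κ X).map f (parOp I c o x) =
        parOp I d ((S n).map f o) (fun i => (delay κ X).map f (x i)) := by
  induction k with
  | zero =>
    intro c d hk f n o x
    rcases forall_now_or_exists_step x with ⟨x', rfl⟩ | hx
    · simp only [parOp_now, map_now, I.op_map]
    · rw [parOp_step I o x hx, parOp_step, map_step]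
      · congr 1
        funext h
        have := κ.level_le f
        omega
      · obtain ⟨i, y, hi⟩ := hx
        exact ⟨i, _, by rw [hi, map_step]⟩
  | succ k ih =>
    intro c d hk f n o x
    rcases forall_now_or_exists_step x with ⟨x', rfl⟩ | hx
    · simp only [parOp_now, map_now, I.op_map]
    · rw [parOp_step I o x hx, parOp_step, map_step]
      · congr 1
        funext h
        rw [ih (by rw [κ.level_next, hk]; rfl)]
        rw [← Functor.map_comp_apply, ← Functor.map_comp_apply, κ.toNext_nextMap]
        simp only [advance_map]
      · obtain ⟨i, y, hi⟩ := hx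
        exact ⟨i, _, by rw [hi, map_step]⟩

variable (κ)

/-- The parallel lifting of an interpretation on `X` to an interpretation on `D^κ X`. -/
def parLift {S : Signature.{w, v} Γ.Elements} {X : Γ.Elements ⥤ Type u} (I : Interp S X) :
    Interp S (delay κ X) where
  op o x := parOp I _ o x
  op_map f _ o x := map_parOp I _ rfl f o x

end Delay

end

end GuardedDelay

namespace GuardedDelay

open FirstOrder.Language (Term)

/-! ### Terms under restriction and substitution; soundness of derivable equations. -/

section Algebra

variable {C : Type w} [Category.{v'} C] {S : Signature.{w, v} C}

/-! The parallel lifting of a term `s` is governed by two data only: its interpretation on `X` and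
the set of variables occurring in it. If every occurring variable is a `now`, the result is `now` of
the value of `s` in `X` (`eval_parLift_now`). If some occurring variable is a `step`, the result is
a `step` whose body is `s` evaluated after one tick of all its arguments (`eval_parLift_eq_step`).

Two terms with the same interpretation on `X` and the same variables therefore fall into the same
case, and induction on the number of ticks left shows that their liftings agree
(`eval_parLift_eq_of_agree`). A drop equation such as `x * 0 = 0` can fail: for `x` a step the left
side is a step and the right side a `now`.

Soundness (`AlgTheory.Valid.agree`) supplies equality on `X` for valid equations. The axioms are
themselves valid, so the claim about models is a special case. -/

theorem Signature.Tm.res_func {c d : C} {m n : ℕ} (f : c ⟶ d) (o : (S n).obj c)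
    (ts : Fin n → S.Tm c m) :
    Signature.Tm.res (S := S) (Term.func (L := S.lang c) o ts) f =
      Term.func (L := S.lang d) ((S n).map f o) fun i => (ts i).res f := rfl

theorem Signature.Tm.res_id {c : C} {m : ℕ} (s : S.Tm c m) :
    Signature.Tm.res s (𝟙 c) = s := by
  induction s with
  | var i => rfl
  | func o ts ih =>
    rw [Signature.Tm.res_func, CategoryTheory.Functor.map_id]
    exact congrArg (Term.func (L := S.lang c) o) (funext ih)

theorem Signature.Tm.res_comp {c d e : C} {m : ℕ} (s : S.Tm c m) (f : c ⟶ d) (g : d ⟶ e) :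
    Signature.Tm.res s (f ≫ g) = Signature.Tm.res (Signature.Tm.res s f) g := by
  induction s with
  | var i => rfl
  | func o ts ih =>
    rw [Signature.Tm.res_func, Signature.Tm.res_func, Signature.Tm.res_func,
      Functor.map_comp_apply]
    exact congrArg (Term.func (L := S.lang e) _) (funext ih)

theorem Signature.Tm.varFinset_res {c d : C} {m : ℕ} (s : S.Tm c m) (f : c ⟶ d) :
    (Signature.Tm.res s f).varFinset = s.varFinset := by
  induction s with
  | var i => rfl
  | func o ts ih =>
    rw [Signature.Tm.res_func]
    simp only [Term.varFinset]
    exact congrArg _ (funext ih)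

theorem Signature.Tm.res_subst {c d : C} {m n : ℕ} (s : S.Tm c n) (σ : Fin n → S.Tm c m)
    (f : c ⟶ d) :
    Signature.Tm.res (s.subst σ) f =
      (Signature.Tm.res s f).subst fun i => Signature.Tm.res (σ i) f := by
  induction s with
  | var i => rfl
  | func o ts ih =>
    rw [Signature.Tm.res_func]
    simp only [Term.subst]
    rw [Signature.Tm.res_func]
    exact congrArg _ (funext ih)

theorem Signature.Tm.subst_var {c : C} {m : ℕ} (s : S.Tm c m) :
    s.subst (fun i => (Term.var i : S.Tm c m)) = s := by
  induction s with
  | var i => rfl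
  | func o ts ih => exact congrArg (Term.func (L := S.lang c) o) (funext ih)

variable {X : C ⥤ Type u} (I : Interp S X)

theorem Interp.eval_func {c : C} {m n : ℕ} (o : (S n).obj c) (ts : Fin n → S.Tm c m)
    (ρ : Fin m → X.obj c) :
    I.eval (Term.func (L := S.lang c) o ts) ρ = I.op o fun i => I.eval (ts i) ρ := rfl

theorem Interp.eval_subst {c : C} {m n : ℕ} (s : S.Tm c n) (σ : Fin n → S.Tm c m)
    (ρ : Fin m → X.obj c) :
    I.eval (s.subst σ) ρ = I.eval s fun i => I.eval (σ i) ρ := by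
  induction s with
  | var i => rfl
  | func o ts ih => exact congrArg (I.op o) (funext ih)

/-- The interpretation of a term depends only on the variables that occur in it. -/
theorem Interp.eval_congr {c : C} {m : ℕ} (s : S.Tm c m) {ρ ρ' : Fin m → X.obj c}
    (h : ∀ i ∈ s.varFinset, ρ i = ρ' i) : I.eval s ρ = I.eval s ρ' := by
  induction s with
  | var i => exact h i (by simp [Term.varFinset])
  | func o ts ih =>
    rw [I.eval_func, I.eval_func]
    refine congrArg (I.op o) (funext fun j => ih j fun i hi => h i ?_)
    simp only [Term.varFinset, Finset.mem_biUnion]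
    exact ⟨j, Finset.mem_univ _, hi⟩

variable {I}

/-- Agreement quantifies over all reachable stages, so it persists. This is what lets the induction
on ticks pass to the next stage. -/
theorem Interp.Agree.res {c d : C} {m : ℕ} {s t : S.Tm c m} (h : I.Agree s t) (f : c ⟶ d) :
    I.Agree (Signature.Tm.res s f) (Signature.Tm.res t f) := by
  intro e g ρ
  rw [← Signature.Tm.res_comp, ← Signature.Tm.res_comp]
  exact h _ ρ

theorem Interp.Agree.eval_eq {c : C} {m : ℕ} {s t : S.Tm c m} (h : I.Agree s t)
    (ρ : Fin m → X.obj c) : I.eval s ρ = I.eval t ρ := by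
  simpa only [Signature.Tm.res_id] using h (𝟙 c) ρ

/-- Soundness: a model satisfies all equations that are valid in the theory. -/
theorem AlgTheory.Valid.agree {A : AlgTheory.{v, v', w} C} {I : Interp A.sig X} (hI : I.IsModel)
    {c : C} {m : ℕ} {s t : A.sig.Tm c m} (h : A.Valid c s t) : I.Agree s t := by
  intro d f ρ
  induction h with
  | ax e σ =>
    -- A substitution instance at `ρ` is the axiom itself evaluated at the values of `σ`.
    rw [Signature.Tm.res_subst, Signature.Tm.res_subst, I.eval_subst, I.eval_subst]
    exact hI e f _
  | refl s => rfl
  | symm _ ih => exact ih.symm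
  | trans _ _ ih₁ ih₂ => exact ih₁.trans ih₂
  | congr o ss ts _ ih =>
    rw [Signature.Tm.res_func, Signature.Tm.res_func, I.eval_func, I.eval_func]
    exact congrArg _ (funext ih)

theorem AlgTheory.valid_eqn (A : AlgTheory.{v, v', w} C) {n : ℕ} {c : C} (e : (A.eqn n).obj c) :
    A.Valid c (A.lhs e) (A.rhs e) := by
  -- An axiom is its own instance under the identity substitution.
  simpa only [Signature.Tm.subst_var] using
    AlgTheory.Valid.ax (A := A) (c := c) e (fun i => Term.var i)

end Algebra

/-! ### Parallel lifting of terms: the `now` case, the `step` case, and ticks. -/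

section Delay

variable {Γ : TimeObj ⥤ Type w} (κ : ClockIn Γ) {S : Signature.{w, v} Γ.Elements}
  {X : Γ.Elements ⥤ Type u} (I : Interp S X)

theorem parLift_op {c : Γ.Elements} {n : ℕ} (o : (S n).obj c)
    (x : Fin n → (delay κ X).obj c) : (parLift κ I).op o x = parOp I c o x := rfl

/-- On terminated computations the parallel lifting of a term is the term itself. -/
theorem eval_parLift_now {c : Γ.Elements} {m : ℕ} (s : S.Tm c m) (ρ : Fin m → X.obj c) :
    (parLift κ I).eval s (fun i => now (ρ i)) = now (I.eval s ρ) := by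
  induction s with
  | var i => rfl
  | func o ts ih =>
    rw [Interp.eval_func, Interp.eval_func, parLift_op, funext ih, parOp_now]

/-- If all the variables that occur have terminated, then so has the term. -/
theorem exists_eval_parLift_eq_now {c : Γ.Elements} {m : ℕ} (s : S.Tm c m)
    (ρ : Fin m → (delay κ X).obj c) (h : ∀ i ∈ s.varFinset, ∃ x, ρ i = now x) :
    ∃ x, (parLift κ I).eval s ρ = now x := by
  induction s with
  | var i => exact h i (by simp [Term.varFinset])
  | func o ts ih =>
    have h' : ∀ j, ∃ x, (parLift κ I).eval (ts j) ρ = now x := fun j => ih j fun i hi => h i <| by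
      simp only [Term.varFinset, Finset.mem_biUnion]
      exact ⟨j, Finset.mem_univ _, hi⟩
    choose x hx using h'
    exact ⟨I.op o x, by rw [Interp.eval_func, parLift_op, funext hx, parOp_now]⟩

/-- If a variable that occurs is a step, then the term takes a step. -/
theorem exists_eval_parLift_eq_step {c : Γ.Elements} {m : ℕ} (s : S.Tm c m)
    (ρ : Fin m → (delay κ X).obj c) (h : ∃ i ∈ s.varFinset, ∃ y, ρ i = step y) :
    ∃ y, (parLift κ I).eval s ρ = step y := by
  induction s with
  | var i =>
    obtain ⟨j, hj, hy⟩ := h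
    simp only [Term.varFinset, Finset.mem_singleton] at hj
    exact hj ▸ hy
  | func o ts ih =>
    obtain ⟨i, hi, hy⟩ := h
    simp only [Term.varFinset, Finset.mem_biUnion] at hi
    obtain ⟨j, -, hj⟩ := hi
    -- One stepping argument suffices, whatever the other arguments are.
    rw [Interp.eval_func, parLift_op, parOp_step I o _ ⟨j, ih j ⟨i, hj, hy⟩⟩]
    exact ⟨_, rfl⟩

/-- On values this is naturality of the operation along `κ.toNext c`; as soon as one argument is a
step, it is the recursive clause of `parOp`. -/
theorem advance_parOp {c : Γ.Elements} (hc : 0 < κ.level c) {n : ℕ} (o : (S n).obj c)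
    (x : Fin n → (delay κ X).obj c) :
    advance hc (parOp I c o x) =
      parOp I (κ.next c) ((S n).map (κ.toNext c) o) fun i => advance hc (x i) := by
  rcases forall_now_or_exists_step x with ⟨x', rfl⟩ | hx
  · rw [parOp_now]
    change now _ = parOp I _ _ fun i => now (X.map (κ.toNext c) (x' i))
    rw [parOp_now, I.op_map]
  · rw [parOp_step I o x hx]
    rfl

/-- One tick of the parallel lifting of a term executes one tick of all its variables. -/
theorem advance_eval_parLift {c : Γ.Elements} (hc : 0 < κ.level c) {m : ℕ} (s : S.Tm c m)
    (ρ : Fin m → (delay κ X).obj c) :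
    advance hc ((parLift κ I).eval s ρ) =
      (parLift κ I).eval (Signature.Tm.res s (κ.toNext c)) fun i => advance hc (ρ i) := by
  induction s with
  | var i => rfl
  | func o ts ih =>
    rw [Signature.Tm.res_func, Interp.eval_func, Interp.eval_func, parLift_op, parLift_op,
      advance_parOp]
    exact congrArg _ (funext ih)

/-- Once the value is known to be a step, `advance` recovers its body, and `advance` commutes with
evaluation. -/
theorem eval_parLift_eq_step {c : Γ.Elements} {m : ℕ} (s : S.Tm c m)
    (ρ : Fin m → (delay κ X).obj c) (h : ∃ i ∈ s.varFinset, ∃ y, ρ i = step y) :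
    (parLift κ I).eval s ρ = step fun hc =>
      (parLift κ I).eval (Signature.Tm.res s (κ.toNext c)) fun i => advance hc (ρ i) := by
  obtain ⟨y, hy⟩ := exists_eval_parLift_eq_step κ I s ρ h
  rw [hy]
  congr 1
  funext hc
  rw [← advance_eval_parLift, hy]
  rfl

/-! ### Preservation of non-drop equations. -/

variable {I}

/-- Parallel lifting preserves the equations between terms with the same variables. -/
theorem eval_parLift_eq_of_agree (k : ℕ) : ∀ {c : Γ.Elements}, κ.level c = k → ∀ {m : ℕ}
    {s t : S.Tm c m}, I.Agree s t → s.varFinset = t.varFinset →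
    ∀ ρ : Fin m → (delay κ X).obj c, (parLift κ I).eval s ρ = (parLift κ I).eval t ρ := by
  induction k using Nat.strong_induction_on with
  | _ k ih =>
    intro c hk m s t hst hvar ρ
    by_cases h : ∃ i ∈ s.varFinset, ∃ y, ρ i = step y
    · rw [eval_parLift_eq_step κ I s ρ h, eval_parLift_eq_step κ I t ρ (hvar ▸ h)]
      congr 1
      funext hc
      -- The tick `hc` forces `0 < k`, so `k - 1 < k`. At level zero there is no tick and nothing to
      -- compare.
      refine ih (k - 1) (by omega) (by rw [κ.level_next, hk]) (hst.res _) ?_ _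
      rw [Signature.Tm.varFinset_res, Signature.Tm.varFinset_res, hvar]
    · have hnow : ∀ i ∈ s.varFinset, ∃ x, ρ i = now x := by
        intro i hi
        cases hx : ρ i with
        | now x => exact ⟨x, rfl⟩
        | step y => exact absurd ⟨i, hi, y, hx⟩ h
      -- `X` is inhabited at this stage, even if no variable occurs.
      obtain ⟨x₀, -⟩ := exists_eval_parLift_eq_now κ I s ρ hnow
      -- Variables that do not occur may still be steps; they receive the dummy value `x₀`, which
      -- neither term sees.
      have hval : ∀ i, ∃ x, i ∈ s.varFinset → ρ i = now x := fun i => by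
        by_cases hi : i ∈ s.varFinset
        · exact (hnow i hi).imp fun _ hx _ => hx
        · exact ⟨x₀, fun hi' => absurd hi' hi⟩
      choose ρ' hρ' using hval
      rw [(parLift κ I).eval_congr s hρ', (parLift κ I).eval_congr t (hvar ▸ hρ'),
        eval_parLift_now, eval_parLift_now, hst.eval_eq]

theorem agree_parLift {c : Γ.Elements} {m : ℕ} {s t : S.Tm c m} (h : I.Agree s t)
    (hvar : ¬ IsDrop s t) : (parLift κ I).Agree s t := by
  intro d f ρ
  -- Restriction preserves both agreement on `X` and the variable sets, so it is enough to compare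
  -- the restricted terms at stage `d`.
  refine eval_parLift_eq_of_agree κ _ rfl (h.res f) ?_ ρ
  rw [Signature.Tm.varFinset_res, Signature.Tm.varFinset_res]
  exact not_not.mp hvar

end Delay

end GuardedDelay

theorem proposition5p2 {Γ : GuardedDelay.TimeObj ⥤ Type w} (κ : GuardedDelay.ClockIn Γ)
    (A : GuardedDelay.AlgTheory.{v, 0, w} Γ.Elements) (X : Γ.Elements ⥤ Type u)
    (I : GuardedDelay.Interp A.sig X) (hI : I.IsModel) :
    (∀ ⦃c : Γ.Elements⦄ ⦃m : ℕ⦄ (s t : A.sig.Tm c m), A.Valid c s t →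
      ¬ GuardedDelay.IsDrop s t → (GuardedDelay.parLift κ I).Agree s t) ∧
    (A.NoDrop → (GuardedDelay.parLift κ I).IsModel) :=
  ⟨fun _ _ _ _ hst hd => GuardedDelay.agree_parLift κ (hst.agree hI) hd,
    fun hA _ _ e => GuardedDelay.agree_parLift κ ((A.valid_eqn e).agree hI) (hA e)⟩
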